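/- Conventions. Matrices are complex, of finite order $N\ge 1$ (rows and columns numbered $1,\dots,N$) or infinite of order $N=\infty$ (numbered by $\mathbb N=\{1,2,\dots\}$). A matrix $(c_{i,j})$ is $(p,q)$-diagonal if $c_{i,j}=0$ whenever $i-j>p$ or $j-i>q$; it is $n$-diagonal if it is $([\frac n2],[\frac{n-1}2])$-diagonal or $([\frac{n-1}2],[\frac n2])$-diagonal. A five-diagonal matrix is para-tridiagonal if $c_{2k,2k+2}=c_{2k+1,2k-1}=0$ for all $k\ge1$ for which these entries exist. Given $a_1,a_2,\dots$ with $|a_n|\le 1$, put $a_0=1$ and $\rho_n=\sqrt{1-|a_n|^2}$; the CMV matrix $C(a)$ has, for $k\ge 0$, in row $2k+1$ the entries $-\rho_{2k}a_{2k+1},\ -\overline{a_{2k}}a_{2k+1},\ -\rho_{2k+1}a_{2k+2},\ \rho_{2k+1}\rho_{2k+2}$ and in row $2k+2$ the entries $\rho_{2k}\rho_{2k+1},\ \overline{a_{2k}}\rho_{2k+1},\ -\overline{a_{2k+1}}a_{2k+2},\ \overline{a_{2k+1}}\rho_{2k+2}$, in both cases in the columns $2k,2k+1,2k+2,2k+3$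 (column $0$ being omitted), and all its other entries are $0$. A CMV matrix of order $\infty$ is $C(a)$ with $|a_n|<1$ for all $n\geq 1$; a CMV matrix of finite order $N$ is the principal submatrix of order $N$ of $C(a)$, which depends only on $a_1,\dots,a_N$, with $|a_n|<1$ for $1\le n<N$ and $|a_N|=1$. A bounded operator $U$ on a complex Hilbert space $H$ is said to have a representation of a given type ($n$-diagonal, CMV, ...) if $H$ has an orthonormal basis with respect to which the matrix $\langle Ub_y,b_x\rangle$ of $U$ is a direct sum of finite or infinite matrices of that type (with an arbitrary set of summands). The $n$-diagonal representations are the minimal representations of a class of operators if every operator of the class has an $n$-diagonal representation, but not all of them have an $(n-1)$-diagonal one. Theorem. Let $H$ be a complex Hilbert space. (1) Every unitary operator on $H$ has a representation as a direct sum of para-tridiagonal CMV matrices; in particular, it has a five-diagonal representation. (2) If $H$ is infinite-dimensional, the minimal representations of the unitary operators on $H$ are five-diagonal: every unitary operator on $H$ has a five-diagonal representation, but some unitary operator on $H$ has no four-diagonal representation. -/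

import Mathlib

universe u

noncomputable section

/-- Index set of a matrix of order `N`, with `N` finite or infinite. Rows and columns are numbered
from `0`. -/
abbrev MatIdx (N : ℕ∞) : Type := {n : ℕ // (n : ℕ∞) < N}

/-- A finite or (one-sided) infinite matrix is `(p, q)`-diagonal if all its entries below the
`p`-th subdiagonal and above the `q`-th superdiagonal vanish. -/
def IsBandMatrix {N : ℕ∞} (p q : ℤ) (c : Matrix (MatIdx N) (MatIdx N) ℂ) : Prop :=
  ∀ i j : MatIdx N, (p < (i.1 : ℤ) - (j.1 : ℤ) ∨ q < (j.1 : ℤ) - (i.1 : ℤ)) → c i j = 0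

/-- `n`-diagonal matrices: `([n/2], [(n-1)/2])`-diagonal or `([(n-1)/2], [n/2])`-diagonal.
Division of integers rounds down here. -/
def IsNDiagonal {N : ℕ∞} (n : ℕ) (c : Matrix (MatIdx N) (MatIdx N) ℂ) : Prop :=
  IsBandMatrix ((n : ℤ) / 2) (((n : ℤ) - 1) / 2) c ∨
    IsBandMatrix (((n : ℤ) - 1) / 2) ((n : ℤ) / 2) c

/-- Para-tridiagonal matrices: five-diagonal matrices such that, in the numbering of rows and
columns from `1`, `c_{2k,2k+2} = c_{2k+1,2k-1} = 0` for all `k ≥ 1`. In the numbering from `0`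
used here, the first entries are at `(i, i+2)`, `i` odd, the second ones at `(j+2, j)`, `j` even. -/
def IsParaTridiagonal {N : ℕ∞} (c : Matrix (MatIdx N) (MatIdx N) ℂ) : Prop :=
  IsNDiagonal 5 c ∧
    (∀ i j : MatIdx N, Odd i.1 → j.1 = i.1 + 2 → c i j = 0) ∧
    (∀ i j : MatIdx N, Even j.1 → i.1 = j.1 + 2 → c i j = 0)

/-- `ρ_n = √(1 - |a_n|²)`, as a complex number. -/
def schurRho (a : ℕ → ℂ) (n : ℕ) : ℂ := (Real.sqrt (1 - ‖a n‖ ^ 2) : ℂ)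

/-- Schur parameters of order `N`, with the convention `a_0 = 1`: for finite `N`, a vector
`(a_1, …, a_N)` with `|a_n| < 1` for `n < N` and `|a_N| = 1` (the values of `a` beyond `N` are
irrelevant); for `N = ∞`, a sequence `(a_n)_{n ≥ 1}` in the open unit disk. -/
def IsSchurParameters (N : ℕ∞) (a : ℕ → ℂ) : Prop :=
  a 0 = 1 ∧ (∀ n : ℕ, 1 ≤ n → (n : ℕ∞) < N → ‖a n‖ < 1) ∧ (∀ n : ℕ, (n : ℕ∞) = N → ‖a n‖ = 1)

/-- The infinite CMV matrix `C(a)`, `a = (a_1, a_2, …)`, `a_0 = 1`: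
```
  -a₁    -ρ₁a₂    ρ₁ρ₂
   ρ₁    -ā₁a₂    ā₁ρ₂     0
   0     -ρ₂a₃   -ā₂a₃   -ρ₃a₄    ρ₃ρ₄
          ρ₂ρ₃    ā₂ρ₃   -ā₃a₄    ā₃ρ₄     0
                  0      -ρ₄a₅   -ā₄a₅   -ρ₅a₆   ρ₅ρ₆
                          ρ₄ρ₅    ā₄ρ₅   -ā₅a₆   ā₅ρ₆   0
                                   …
``` -/
def cmvEntry (a : ℕ → ℂ) (i j : ℕ) : ℂ :=
  if Even i then
    if j + 1 = i then -(schurRho a i * a (i + 1))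
    else if j = i then -(star (a i) * a (i + 1))
    else if j = i + 1 then -(schurRho a (i + 1) * a (i + 2))
    else if j = i + 2 then schurRho a (i + 1) * schurRho a (i + 2)
    else 0
  else
    if j + 2 = i then schurRho a (i - 1) * schurRho a i
    else if j + 1 = i then star (a (i - 1)) * schurRho a i
    else if j = i then -(star (a i) * a (i + 1))
    else if j = i + 1 then star (a i) * schurRho a (i + 1)
    else 0

/-- The matrix `c` of order `N` is the CMV matrix `C(a)` (for `N` finite, its principal submatrix
`C(a_1, …, a_N)` of order `N`) of some Schur parameters of order `N`. -/
def IsCMV {N : ℕ∞} (c : Matrix (MatIdx N) (MatIdx N) ℂ) : Prop :=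
  ∃ a : ℕ → ℂ, IsSchurParameters N a ∧ ∀ i j : MatIdx N, c i j = cmvEntry a i.1 j.1

open Classical in
/-- The operator `U` has a matrix representation of type `P`: for some orthonormal (Hilbert) basis
`b`, the matrix `(⟨b_x, U b_y⟩)` of `U` is an orthogonal (direct) sum, over an arbitrary index set
`κ`, of finite or infinite matrices of type `P`. -/
def HasRepresentation {H : Type u} [NormedAddCommGroup H] [InnerProductSpace ℂ H]
    (P : ∀ N : ℕ∞, Matrix (MatIdx N) (MatIdx N) ℂ → Prop) (U : H →L[ℂ] H) : Prop :=
  ∃ (κ : Type u) (N : κ → ℕ∞) (M : ∀ k, Matrix (MatIdx (N k)) (MatIdx (N k)) ℂ)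
    (b : HilbertBasis (Σ k, MatIdx (N k)) ℂ H),
    (∀ k, 0 < N k) ∧ (∀ k, P (N k) (M k)) ∧
      ∀ x y, inner ℂ (b x) (U (b y)) = Matrix.blockDiagonal' M x y

/-- `U` has an `n`-diagonal representation. -/
def HasNDiagonalRepresentation {H : Type u} [NormedAddCommGroup H] [InnerProductSpace ℂ H]
    (n : ℕ) (U : H →L[ℂ] H) : Prop :=
  HasRepresentation (fun _ c => IsNDiagonal n c) U

/-- The `n`-diagonal representations are the minimal representations of the class `𝒰`: every
operator of the class has an `n`-diagonal representation, but not all of them have an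
`(n-1)`-diagonal one. -/
def IsMinimalRepresentation {H : Type u} [NormedAddCommGroup H] [InnerProductSpace ℂ H]
    (n : ℕ) (𝒰 : Set (H →L[ℂ] H)) : Prop :=
  (∀ U ∈ 𝒰, HasNDiagonalRepresentation n U) ∧
    ¬ ∀ U ∈ 𝒰, HasNDiagonalRepresentation (n - 1) U

end

/-!
A unitary operator `T` is reduced to cyclic subspaces, where a two-term recursion produces a CMV
basis; bilateral shifts show that five diagonals are needed.

*Existence.* Starting from a unit vector `v`, a pair of vectors `(e, h)` is iterated, beginning with
`(v, T v)`. With `c = -⟪e, h⟫` and `r = √(1 - |c|²)`, put `e' = r⁻¹ (h + c e)`, `k = r⁻¹ (e + c̄ h)`;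
the next pair is `(e', T⁻¹ k)`, and for it the roles of `T` and `T⁻¹` are exchanged. If `V` is the
span of the preceding vectors `e`, then both `e` and `h` are unit vectors orthogonal to `V` and
`T (V ⊔ ⟨e⟩) = V ⊔ ⟨h⟩`. These properties are inherited by the next pair (`IsBalanced.step`),
because `(e, e')` and `(h, k)` are related by a unitary `2 × 2` matrix with entries `r, r, c, -c̄` as
long as `|c| < 1`. Hence the vectors `e` are orthonormal (`inner_cmvVec`), they span a subspace
invariant under `T` and `T⁻¹`, and composing two consecutive `2 × 2` relations gives the entries of
the CMV matrix (`inner_cmvVec_map`). The process stops exactly at a parameter of modulus one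
(`exists_isSchurParameters`). By Zorn's lemma the space is an orthogonal sum of cyclic subspaces
(`exists_orthogonalGenerators`).

*Minimality.* The rows and columns of an infinite `(1, 2)`-diagonal unitary matrix with nonvanishing
subdiagonal are so sparse that orthogonality of columns forces it to be a shift from row `3` on, and
then it is not invertible (`false_of_infinite_hessenberg_block`). Therefore every block of a
four-diagonal representation of `T` or of `T⁻¹` has a nonzero finite-dimensional invariant subspace,
so `T` has an eigenvector (`exists_eigenvector_of_hasNDiagonalRepresentation_four`). On an
infinite-dimensional space a direct sum of bilateral shifts is a unitary operator without
eigenvectors.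
-/

open Submodule

variable {H : Type u} [NormedAddCommGroup H] [InnerProductSpace ℂ H]

/-! ### The Szegő step -/

/-- The Schur parameter of a pair of vectors: minus their inner product. -/
noncomputable def schurCoeff (e h : H) : ℂ := -inner ℂ e h

/-- The complementary parameter `√(1 - |c|²)` of the Schur parameter `c` of a pair of vectors. -/
noncomputable def schurCompl (e h : H) : ℝ := √(1 - ‖schurCoeff e h‖ ^ 2)

/-- For unit vectors `e` and `h`, the normalized component of `h` orthogonal to `e`. It is `0` if `h`
is a multiple of `e`, by the convention on division by zero. -/
noncomputable def szegoFst (e h : H) : H :=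
  (schurCompl e h : ℂ)⁻¹ • (h + schurCoeff e h • e)

/-- For unit vectors `e` and `h`, the normalized component of `e` orthogonal to `h`. It is `0` if `e`
is a multiple of `h`. -/
noncomputable def szegoSnd (e h : H) : H :=
  (schurCompl e h : ℂ)⁻¹ • (e + star (schurCoeff e h) • h)

/-- A pair of vectors is balanced if both are unit vectors or both vanish. The second case covers
the steps after the recursion has terminated, so that it can be run for all natural numbers. -/
def IsBalanced {E : Type*} [NormedAddCommGroup E] (e h : E) : Prop :=
  (‖e‖ = 1 ∧ ‖h‖ = 1) ∨ (e = 0 ∧ h = 0)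

theorem star_schurCoeff (e h : H) : star (schurCoeff e h) = schurCoeff h e := by
  simp [schurCoeff]

theorem schurCompl_comm (e h : H) : schurCompl e h = schurCompl h e := by
  rw [schurCompl, schurCompl, ← star_schurCoeff, norm_star]

theorem szegoSnd_eq_szegoFst (e h : H) : szegoSnd e h = szegoFst h e := by
  rw [szegoSnd, szegoFst, schurCompl_comm, star_schurCoeff]

namespace IsBalanced

variable {e h : H}

theorem symm {E : Type*} [NormedAddCommGroup E] {e h : E} (hb : IsBalanced e h) : IsBalanced h e :=
  hb.imp And.symm And.symm

theorem norm_schurCoeff_le (hb : IsBalanced e h) : ‖schurCoeff e h‖ ≤ 1 := by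
  rcases hb with ⟨h1, h2⟩ | ⟨h1, h2⟩
  · simpa [schurCoeff, h1, h2] using norm_inner_le_norm (𝕜 := ℂ) e h
  · simp [schurCoeff, h1]

theorem sq_schurCompl (hb : IsBalanced e h) :
    schurCompl e h ^ 2 = 1 - ‖schurCoeff e h‖ ^ 2 := by
  have := hb.norm_schurCoeff_le
  rw [schurCompl, Real.sq_sqrt]
  nlinarith [norm_nonneg (schurCoeff e h)]

theorem norm_add_smul_sq (hb : IsBalanced e h) (he : e ≠ 0) :
    ‖h + schurCoeff e h • e‖ ^ 2 = schurCompl e h ^ 2 := by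
  rcases hb.resolve_right (fun H => he H.1) with ⟨h1, h2⟩
  rw [hb.sq_schurCompl, @norm_add_sq ℂ, norm_smul, h1, h2, inner_smul_right]
  have : inner ℂ h e = -star (schurCoeff e h) := by simp [schurCoeff]
  rw [this, mul_neg, ← starRingEnd_apply, RCLike.mul_conj, map_neg]
  norm_cast
  simp
  ring

theorem norm_szegoFst (hb : IsBalanced e h) (he : e ≠ 0) (hr : schurCompl e h ≠ 0) :
    ‖szegoFst e h‖ = 1 := by
  have h0 : 0 ≤ schurCompl e h := Real.sqrt_nonneg _
  have := (sq_eq_sq₀ (norm_nonneg _) h0).1 (hb.norm_add_smul_sq he)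
  rw [szegoFst, norm_smul, this, norm_inv, Complex.norm_real, Real.norm_of_nonneg h0,
    inv_mul_cancel₀ hr]

theorem szegoFst_eq_zero (hb : IsBalanced e h) (H : e = 0 ∨ schurCompl e h = 0) :
    szegoFst e h = 0 := by
  rcases H with he | hr
  · have : h = 0 := by
      rcases hb with hb | hb
      · simp [he] at hb
      · exact hb.2
    simp [szegoFst, he, this]
  · simp [szegoFst, hr]

theorem eq_zero_iff {E : Type*} [NormedAddCommGroup E] {e h : E} (hb : IsBalanced e h) :
    e = 0 ↔ h = 0 := by
  rcases hb with ⟨h1, h2⟩ | ⟨h1, h2⟩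
  · constructor <;> rintro rfl <;> simp_all
  · simp [h1, h2]

theorem szego (hb : IsBalanced e h) : IsBalanced (szegoFst e h) (szegoSnd e h) := by
  rw [szegoSnd_eq_szegoFst]
  by_cases H : e = 0 ∨ schurCompl e h = 0
  · right
    refine ⟨hb.szegoFst_eq_zero H, hb.symm.szegoFst_eq_zero ?_⟩
    rwa [hb.eq_zero_iff, schurCompl_comm] at H
  · push Not at H
    left
    refine ⟨hb.norm_szegoFst H.1 H.2, hb.symm.norm_szegoFst ?_ ?_⟩
    · rw [Ne, ← hb.eq_zero_iff]; exact H.1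
    · rw [schurCompl_comm]; exact H.2

/-- The relation defining `szegoFst` holds without division also if `e` and `h` are proportional:
both sides vanish then. -/
theorem smul_szegoFst (hb : IsBalanced e h) :
    (schurCompl e h : ℂ) • szegoFst e h = h + schurCoeff e h • e := by
  by_cases hr : schurCompl e h = 0
  · by_cases he : e = 0
    · rw [hb.szegoFst_eq_zero (.inl he), hb.eq_zero_iff.1 he, he]; simp
    · have := hb.norm_add_smul_sq he
      rw [hr] at this
      simp at this
      simp [hr, this]
  · rw [szegoFst, smul_inv_smul₀]
    exact_mod_cast hr

theorem smul_szegoSnd (hb : IsBalanced e h) :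
    (schurCompl e h : ℂ) • szegoSnd e h = e + star (schurCoeff e h) • h := by
  rw [szegoSnd_eq_szegoFst, star_schurCoeff, schurCompl_comm, hb.symm.smul_szegoFst]

theorem snd_eq (hb : IsBalanced e h) :
    h = (schurCompl e h : ℂ) • szegoFst e h - schurCoeff e h • e := by
  rw [hb.smul_szegoFst]; abel

theorem fst_eq (hb : IsBalanced e h) :
    e = (schurCompl e h : ℂ) • szegoSnd e h - star (schurCoeff e h) • h := by
  rw [hb.smul_szegoSnd]; abel

/-- This relation and the next one express one of the orthogonal pairs `(e, szegoFst e h)` and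
`(h, szegoSnd e h)` through the other. If the process terminates at `(e, h)`, both are `0 = 0`. -/
theorem szegoFst_eq_smul_add (hb : IsBalanced e h) :
    szegoFst e h = (schurCompl e h : ℂ) • h + schurCoeff e h • szegoSnd e h := by
  by_cases hr : schurCompl e h = 0
  · simp [szegoFst, szegoSnd, hr]
  have hr' : (schurCompl e h : ℂ) ≠ 0 := by exact_mod_cast hr
  have h2 : (schurCompl e h : ℂ) ^ 2 = 1 - schurCoeff e h * star (schurCoeff e h) := by
    rw [← starRingEnd_apply, RCLike.mul_conj]
    simpa using congrArg (fun x : ℝ => (x : ℂ)) hb.sq_schurCompl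
  apply smul_right_injective H hr'
  change (schurCompl e h : ℂ) • szegoFst e h = (schurCompl e h : ℂ) • _
  rw [hb.smul_szegoFst, smul_add, smul_comm _ (schurCoeff e h), hb.smul_szegoSnd, smul_smul,
    ← sq, h2]
  module

theorem szegoSnd_eq_smul_add (hb : IsBalanced e h) :
    szegoSnd e h = (schurCompl e h : ℂ) • e + star (schurCoeff e h) • szegoFst e h := by
  rw [szegoSnd_eq_szegoFst, star_schurCoeff, schurCompl_comm, hb.symm.szegoFst_eq_smul_add,
    szegoSnd_eq_szegoFst]

theorem inner_szegoFst (hb : IsBalanced e h) : inner ℂ e (szegoFst e h) = 0 := by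
  rw [szegoFst, inner_smul_right, inner_add_right, inner_smul_right, inner_self_eq_norm_sq_to_K]
  rcases hb with ⟨h1, h2⟩ | ⟨h1, h2⟩
  · simp [schurCoeff, h1]
  · simp [h1]

theorem inner_szegoSnd (hb : IsBalanced e h) : inner ℂ h (szegoSnd e h) = 0 := by
  rw [szegoSnd_eq_szegoFst, hb.symm.inner_szegoFst]

/-- The invariants that make the Szegő step produce an orthonormal basis adapted to `T` pass to
the next pair of vectors, with `T` replaced by its inverse. -/
theorem step (T : H ≃ₗᵢ[ℂ] H) (V : Submodule ℂ H) (hb : IsBalanced e h)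
    (he : e ∈ Vᗮ) (hh : h ∈ Vᗮ)
    (hT : (V ⊔ span ℂ {e}).map (T.toLinearEquiv : H →ₗ[ℂ] H) = V ⊔ span ℂ {h}) :
    szegoFst e h ∈ (V ⊔ span ℂ {e})ᗮ ∧ T.symm (szegoSnd e h) ∈ (V ⊔ span ℂ {e})ᗮ ∧
      (V ⊔ span ℂ {e} ⊔ span ℂ {szegoFst e h}).map (T.symm.toLinearEquiv : H →ₗ[ℂ] H) =
        V ⊔ span ℂ {e} ⊔ span ℂ {T.symm (szegoSnd e h)} := by
  have h1 : szegoFst e h ∈ Vᗮ := smul_mem _ _ (add_mem hh (smul_mem _ _ he))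
  have h2 : szegoSnd e h ∈ Vᗮ := smul_mem _ _ (add_mem he (smul_mem _ _ hh))
  have key : V ⊔ span ℂ {e} ⊔ span ℂ {szegoFst e h} = V ⊔ span ℂ {h} ⊔ span ℂ {szegoSnd e h} := by
    rw [sup_assoc, sup_assoc]
    congr 1
    have aux (x y z w : H) (a b c d : ℂ) (hx : x = b • w - a • z) (hy : y = c • z + d • w) :
        span ℂ {x} ⊔ span ℂ {y} ≤ span ℂ {z} ⊔ span ℂ {w} := by
      rw [sup_le_iff, span_singleton_le_iff_mem, span_singleton_le_iff_mem, ← span_insert,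
        mem_span_pair, mem_span_pair]
      exact ⟨⟨-a, b, by rw [hx, neg_smul, neg_add_eq_sub]⟩, ⟨c, d, hy.symm⟩⟩
    exact le_antisymm (aux _ _ _ _ _ _ _ _ hb.fst_eq hb.szegoFst_eq_smul_add)
      (aux _ _ _ _ _ _ _ _ hb.snd_eq hb.szegoSnd_eq_smul_add)
  refine ⟨?_, ?_, ?_⟩
  · rw [← inf_orthogonal]
    refine ⟨h1, ?_⟩
    rw [SetLike.mem_coe, mem_orthogonal_singleton_iff_inner_right]
    exact hb.inner_szegoFst
  · have h3 : szegoSnd e h ∈ (V ⊔ span ℂ {h})ᗮ := by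
      rw [← inf_orthogonal]
      refine ⟨h2, ?_⟩
      rw [SetLike.mem_coe, mem_orthogonal_singleton_iff_inner_right]
      exact hb.inner_szegoSnd
    intro x hx
    rw [← T.inner_map_map, T.apply_symm_apply]
    apply h3
    rw [← hT]
    exact mem_map_of_mem hx
  · rw [key, Submodule.map_sup, ← hT, map_span, Set.image_singleton]
    congr 1
    rw [← Submodule.map_comp]
    convert Submodule.map_id _
    ext x
    simp

end IsBalanced

/-! ### The CMV basis of a cyclic subspace -/

/-- `T` for even `n` and its inverse for odd `n`. -/
def alternate (T : H ≃ₗᵢ[ℂ] H) (n : ℕ) : H ≃ₗᵢ[ℂ] H := if Even n then T else T.symm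

theorem alternate_of_even (T : H ≃ₗᵢ[ℂ] H) {n : ℕ} (hn : Even n) : alternate T n = T :=
  if_pos hn

theorem alternate_of_odd (T : H ≃ₗᵢ[ℂ] H) {n : ℕ} (hn : Odd n) : alternate T n = T.symm :=
  if_neg (Nat.not_even_iff_odd.2 hn)

theorem alternate_succ (T : H ≃ₗᵢ[ℂ] H) (n : ℕ) :
    alternate T (n + 1) = (alternate T n).symm := by
  rcases Nat.even_or_odd n with hn | hn
  · rw [alternate_of_even T hn, alternate_of_odd T hn.add_one]
  · rw [alternate_of_odd T hn, alternate_of_even T hn.add_one, LinearIsometryEquiv.symm_symm]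

/-- The `n`-th CMV vector generated by `v`, together with an auxiliary vector. In terms of the
orthonormal polynomials `φ_n` on the unit circle for the spectral measure of the unit vector `v` and
of the reversed polynomials `φ_n^*`, the pair is `(T^{-k} φ_n^*(T) v, T^{1-k} φ_n(T) v)` for `n = 2k`
and `(T^{-k} φ_n(T) v, T^{-k-1} φ_n^*(T) v)` for `n = 2k + 1`. Both vectors vanish from the index on
at which the process terminates. -/
noncomputable def cmvPair (T : H ≃ₗᵢ[ℂ] H) (v : H) : ℕ → H × H
  | 0 => (v, T v)
  | n + 1 => (szegoFst (cmvPair T v n).1 (cmvPair T v n).2,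
      (alternate T n).symm (szegoSnd (cmvPair T v n).1 (cmvPair T v n).2))

/-- The CMV vectors generated by `v`. -/
noncomputable def cmvVec (T : H ≃ₗᵢ[ℂ] H) (v : H) (n : ℕ) : H := (cmvPair T v n).1

/-- The auxiliary vectors of the CMV process. -/
noncomputable def cmvAux (T : H ≃ₗᵢ[ℂ] H) (v : H) (n : ℕ) : H := (cmvPair T v n).2

/-- The span of the first `n` CMV vectors generated by `v`. -/
noncomputable def cmvFlag (T : H ≃ₗᵢ[ℂ] H) (v : H) (n : ℕ) : Submodule ℂ H :=
  span ℂ (cmvVec T v '' Set.Iio n)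

/-- The Schur parameters of the vector `v`, preceded by `1`. -/
noncomputable def schurParam (T : H ≃ₗᵢ[ℂ] H) (v : H) : ℕ → ℂ
  | 0 => 1
  | n + 1 => if Even n then schurCoeff (cmvVec T v n) (cmvAux T v n)
      else star (schurCoeff (cmvVec T v n) (cmvAux T v n))

section

variable (T : H ≃ₗᵢ[ℂ] H) (v : H)

theorem cmvVec_succ (n : ℕ) : cmvVec T v (n + 1) = szegoFst (cmvVec T v n) (cmvAux T v n) := rfl

theorem cmvAux_succ (n : ℕ) :
    cmvAux T v (n + 1) = (alternate T n).symm (szegoSnd (cmvVec T v n) (cmvAux T v n)) := rfl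

theorem cmvFlag_succ (n : ℕ) :
    cmvFlag T v (n + 1) = cmvFlag T v n ⊔ span ℂ {cmvVec T v n} := by
  have : Set.Iio (n + 1) = insert n (Set.Iio n) := by
    ext i
    simp [Order.lt_add_one_iff, le_iff_eq_or_lt]
  rw [cmvFlag, this, Set.image_insert_eq, span_insert, sup_comm, cmvFlag]

theorem cmvVec_mem_cmvFlag {m n : ℕ} (h : m < n) : cmvVec T v m ∈ cmvFlag T v n :=
  subset_span ⟨m, h, rfl⟩

variable {v}

theorem isBalanced_cmv (hv : ‖v‖ = 1) (n : ℕ) : IsBalanced (cmvVec T v n) (cmvAux T v n) := by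
  induction n with
  | zero => exact .inl ⟨hv, (T.norm_map v).trans hv⟩
  | succ n ih =>
    rw [cmvVec_succ, cmvAux_succ]
    rcases ih.szego with h | h
    · exact .inl ⟨h.1, by rw [LinearIsometryEquiv.norm_map, h.2]⟩
    · exact .inr ⟨h.1, by rw [h.2, map_zero]⟩

/-- The invariants of the CMV process: both vectors of the pair are orthogonal to the preceding CMV
vectors, and `T` or its inverse, depending on the parity of `n`, maps the span of the CMV vectors up
to the `n`-th onto the span of the preceding ones and the `n`-th auxiliary vector. -/
theorem cmv_invariants (hv : ‖v‖ = 1) (n : ℕ) :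
    cmvVec T v n ∈ (cmvFlag T v n)ᗮ ∧ cmvAux T v n ∈ (cmvFlag T v n)ᗮ ∧
      (cmvFlag T v (n + 1)).map ((alternate T n).toLinearEquiv : H →ₗ[ℂ] H) =
        cmvFlag T v n ⊔ span ℂ {cmvAux T v n} := by
  induction n with
  | zero =>
    have h0 : cmvFlag T v 0 = ⊥ := by simp [cmvFlag]
    rw [cmvFlag_succ, h0]
    refine ⟨by simp, by simp, ?_⟩
    rw [bot_sup_eq, bot_sup_eq, map_span, Set.image_singleton, alternate_of_even T Even.zero]
    rfl
  | succ n ih =>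
    obtain ⟨h1, h2, h3⟩ := ih
    rw [cmvFlag_succ] at h3
    rw [cmvFlag_succ T v (n + 1), cmvFlag_succ T v n, cmvVec_succ, cmvAux_succ, alternate_succ]
    exact (isBalanced_cmv T hv n).step (alternate T n) _ h1 h2 h3

theorem norm_cmvVec (hv : ‖v‖ = 1) {n : ℕ} (hn : cmvVec T v n ≠ 0) : ‖cmvVec T v n‖ = 1 :=
  ((isBalanced_cmv T hv n).resolve_right fun h => hn h.1).1

theorem inner_cmvVec_of_lt (hv : ‖v‖ = 1) {m n : ℕ} (h : m < n) :
    inner ℂ (cmvVec T v m) (cmvVec T v n) = 0 :=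
  (cmv_invariants T hv n).1 _ (cmvVec_mem_cmvFlag T v h)

theorem inner_cmvVec (hv : ‖v‖ = 1) {m : ℕ} (hm : cmvVec T v m ≠ 0) (n : ℕ) :
    inner ℂ (cmvVec T v m) (cmvVec T v n) = if n = m then 1 else 0 := by
  split_ifs with h
  · rw [h, inner_self_eq_norm_sq_to_K, norm_cmvVec T hv hm]; simp
  · rcases Nat.lt_or_gt_of_ne h with h | h
    · rw [inner_eq_zero_symm, inner_cmvVec_of_lt T hv h]
    · exact inner_cmvVec_of_lt T hv h

theorem norm_schurParam_succ (n : ℕ) :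
    ‖schurParam T v (n + 1)‖ = ‖schurCoeff (cmvVec T v n) (cmvAux T v n)‖ := by
  rw [schurParam]
  split_ifs <;> simp

theorem schurRho_schurParam_succ (n : ℕ) :
    schurRho (schurParam T v) (n + 1) = schurCompl (cmvVec T v n) (cmvAux T v n) := by
  rw [schurRho, norm_schurParam_succ, schurCompl]

/-- The process terminates exactly when a unimodular Schur parameter shows up. -/
theorem cmvVec_succ_ne_zero_iff (hv : ‖v‖ = 1) (n : ℕ) :
    cmvVec T v (n + 1) ≠ 0 ↔ cmvVec T v n ≠ 0 ∧ ‖schurParam T v (n + 1)‖ < 1 := by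
  have hb := isBalanced_cmv T hv n
  have h1 := hb.norm_schurCoeff_le
  have hiff : schurCompl (cmvVec T v n) (cmvAux T v n) = 0 ↔ ¬ ‖schurParam T v (n + 1)‖ < 1 := by
    rw [norm_schurParam_succ, ← sq_eq_zero_iff, hb.sq_schurCompl, sub_eq_zero, eq_comm,
      pow_eq_one_iff_of_nonneg (norm_nonneg _) two_ne_zero, not_lt]
    exact ⟨fun h => h.ge, fun h => le_antisymm h1 h⟩
  rw [cmvVec_succ]
  constructor
  · intro h
    by_contra h'
    apply h
    apply hb.szegoFst_eq_zero
    rw [hiff]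
    tauto
  · rintro ⟨h, h'⟩ h0
    have := hb.norm_szegoFst h (by rw [Ne, hiff]; exact not_not.2 h')
    simp [h0] at this

/-- The Schur parameters have the order given by the number of nonzero CMV vectors. -/
theorem exists_isSchurParameters (hv : ‖v‖ = 1) :
    ∃ N : ℕ∞, 0 < N ∧ IsSchurParameters N (schurParam T v) ∧
      ∀ n : ℕ, cmvVec T v n ≠ 0 ↔ (n : ℕ∞) < N := by
  classical
  have hv0 : v ≠ 0 := by rintro rfl; simp at hv
  by_cases H : ∃ n, cmvVec T v n = 0
  · have hlt (n : ℕ) : cmvVec T v n ≠ 0 ↔ n < Nat.find H := by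
      constructor
      · intro h
        by_contra! h'
        apply h
        induction n, h' using Nat.le_induction with
        | base => exact Nat.find_spec H
        | succ n _ ih =>
          have := cmvVec_succ_ne_zero_iff T hv n
          tauto
      · exact Nat.find_min H
    refine ⟨Nat.find H, ?_, ⟨rfl, ?_, ?_⟩, fun n => by rw [hlt]; norm_cast⟩
    · exact_mod_cast (hlt 0).1 hv0
    · rintro (_ | n) h1 h2
      · omega
      · exact ((cmvVec_succ_ne_zero_iff T hv n).1 ((hlt _).2 (by exact_mod_cast h2))).2
    · intro n hn
      have hn : n = Nat.find H := by exact_mod_cast hn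
      have h1 := hlt n
      rcases n with _ | n
      · exact absurd ((hlt 0).1 hv0) (by omega)
      · have h2 := (hlt n).2 (by omega)
        have h3 := cmvVec_succ_ne_zero_iff T hv n
        refine le_antisymm ?_ ?_
        · rw [norm_schurParam_succ]
          exact (isBalanced_cmv T hv n).norm_schurCoeff_le
        · by_contra! h4
          have := h1.1 (h3.2 ⟨h2, h4⟩)
          omega
  · push Not at H
    refine ⟨⊤, by simp, ⟨rfl, fun n h1 _ => ?_, by simp⟩, fun n => by simp [H]⟩
    rcases n with _ | n
    · omega
    · exact ((cmvVec_succ_ne_zero_iff T hv n).1 (H _)).2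

/-! ### The CMV matrix -/

theorem cmvAux_of_even (hv : ‖v‖ = 1) {n : ℕ} (hn : Even n) :
    cmvAux T v n = schurRho (schurParam T v) (n + 1) • cmvVec T v (n + 1) -
      schurParam T v (n + 1) • cmvVec T v n := by
  rw [schurRho_schurParam_succ, schurParam, if_pos hn, cmvVec_succ]
  exact (isBalanced_cmv T hv n).snd_eq

theorem map_cmvAux_succ_of_even (hv : ‖v‖ = 1) {n : ℕ} (hn : Even n) :
    T (cmvAux T v (n + 1)) = schurRho (schurParam T v) (n + 1) • cmvVec T v n +
      star (schurParam T v (n + 1)) • cmvVec T v (n + 1) := by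
  rw [schurRho_schurParam_succ, schurParam, if_pos hn, cmvAux_succ, alternate_of_even T hn,
    T.apply_symm_apply]
  exact (isBalanced_cmv T hv n).szegoSnd_eq_smul_add

theorem map_cmvVec_of_odd (hv : ‖v‖ = 1) {n : ℕ} (hn : Odd n) :
    T (cmvVec T v n) = schurRho (schurParam T v) (n + 1) • cmvAux T v (n + 1) -
      schurParam T v (n + 1) • T (cmvAux T v n) := by
  rw [schurRho_schurParam_succ, schurParam, if_neg (Nat.not_even_iff_odd.2 hn), cmvAux_succ,
    alternate_of_odd T hn, LinearIsometryEquiv.symm_symm, ← map_smul, ← map_smul, ← map_sub]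
  exact congrArg T (isBalanced_cmv T hv n).fst_eq

theorem map_cmvVec_succ_of_odd (hv : ‖v‖ = 1) {n : ℕ} (hn : Odd n) :
    T (cmvVec T v (n + 1)) = schurRho (schurParam T v) (n + 1) • T (cmvAux T v n) +
      star (schurParam T v (n + 1)) • cmvAux T v (n + 1) := by
  rw [schurRho_schurParam_succ, schurParam, if_neg (Nat.not_even_iff_odd.2 hn), star_star,
    cmvAux_succ,
    alternate_of_odd T hn, LinearIsometryEquiv.symm_symm, ← map_smul, ← map_smul, ← map_add]
  exact congrArg T (isBalanced_cmv T hv n).szegoFst_eq_smul_add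

/-- In the CMV basis, the matrix of `T` is the CMV matrix of the Schur parameters. -/
theorem inner_cmvVec_map (hv : ‖v‖ = 1) {i : ℕ} (hi : cmvVec T v i ≠ 0) (j : ℕ) :
    inner ℂ (cmvVec T v i) (T (cmvVec T v j)) = cmvEntry (schurParam T v) i j := by
  -- Each `T e_j` is a combination of at most four basis vectors; for `i` outside these, the
  -- parity of `i` decides the branch of `cmvEntry`.
  have hp := Nat.mod_two_eq_zero_or_one i
  rcases Nat.even_or_odd j with hj | hj
  · rcases j with _ | j
    · have h0 : T (cmvVec T v 0) = cmvAux T v 0 := rfl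
      have h1 : schurParam T v 0 = 1 := rfl
      rw [h0, cmvAux_of_even T hv Even.zero]
      simp only [inner_sub_right, inner_smul_right, inner_cmvVec T hv hi, cmvEntry, Nat.even_iff]
      rcases (by omega : i = 0 ∨ i = 1 ∨ i = 2 ∨ 3 ≤ i) with rfl | rfl | rfl | h
      all_goals rcases hp with hp | hp <;> try omega
      all_goals repeat first | rw [if_pos (by omega)] | rw [if_neg (by omega)]
      all_goals simp [h1]
    · obtain ⟨n, rfl⟩ : ∃ n, j = 2 * n + 1 := by
        obtain ⟨n, hn⟩ := hj
        exact ⟨n - 1, by omega⟩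
      rw [map_cmvVec_succ_of_odd T hv (by simp), map_cmvAux_succ_of_even T hv (by simp),
        cmvAux_of_even T hv ⟨n + 1, by omega⟩]
      simp only [inner_sub_right, inner_add_right, inner_smul_right, inner_cmvVec T hv hi,
        cmvEntry, Nat.even_iff]
      rcases (by omega : i = 2 * n ∨ i = 2 * n + 1 ∨ i = 2 * n + 2 ∨ i = 2 * n + 3 ∨
        (i ≠ 2 * n ∧ i ≠ 2 * n + 1 ∧ i ≠ 2 * n + 2 ∧ i ≠ 2 * n + 3))
        with rfl | rfl | rfl | rfl | h
      all_goals rcases hp with hp | hp <;> try omega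
      all_goals repeat first | rw [if_pos (by omega)] | rw [if_neg (by omega)]
      all_goals simp [mul_comm]
  · obtain ⟨n, rfl⟩ := hj
    rw [map_cmvVec_of_odd T hv (by simp), map_cmvAux_succ_of_even T hv (by simp),
      cmvAux_of_even T hv ⟨n + 1, by omega⟩]
    simp only [inner_sub_right, inner_add_right, inner_smul_right, inner_cmvVec T hv hi, cmvEntry,
      Nat.even_iff]
    rcases (by omega : i = 2 * n ∨ i = 2 * n + 1 ∨ i = 2 * n + 2 ∨ i = 2 * n + 3 ∨
      (i ≠ 2 * n ∧ i ≠ 2 * n + 1 ∧ i ≠ 2 * n + 2 ∧ i ≠ 2 * n + 3))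
      with rfl | rfl | rfl | rfl | h
    all_goals rcases hp with hp | hp <;> try omega
    all_goals repeat first | rw [if_pos (by omega)] | rw [if_neg (by omega)]
    all_goals simp [mul_comm]

end

/-! ### Direct sums of CMV matrices -/

theorem IsCMV.isParaTridiagonal {N : ℕ∞} {c : Matrix (MatIdx N) (MatIdx N) ℂ} (hc : IsCMV c) :
    IsParaTridiagonal c := by
  obtain ⟨a, -, hc⟩ := hc
  refine ⟨.inl fun i j h => ?_, fun i j h h' => ?_, fun i j h h' => ?_⟩
  all_goals
    rw [hc, cmvEntry]
    simp only [Nat.even_iff, Nat.odd_iff] at *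
    split_ifs <;> first | omega | rfl

section

variable (T : H ≃ₗᵢ[ℂ] H) {v : H}

theorem cmvFlag_le_span_range (v : H) (n : ℕ) :
    cmvFlag T v n ≤ span ℂ (Set.range (cmvVec T v)) :=
  span_mono (Set.image_subset_range _ _)

theorem alternate_cmvVec_mem (hv : ‖v‖ = 1) {m n : ℕ} (h : m ≤ n) :
    alternate T n (cmvVec T v m) ∈ span ℂ (Set.range (cmvVec T v)) := by
  have h1 : alternate T n (cmvVec T v m) ∈
      (cmvFlag T v (n + 1)).map ((alternate T n).toLinearEquiv : H →ₗ[ℂ] H) :=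
    mem_map_of_mem (cmvVec_mem_cmvFlag T v (Nat.lt_succ_of_le h))
  rw [(cmv_invariants T hv n).2.2] at h1
  refine sup_le (cmvFlag_le_span_range T v n) ?_ h1
  rw [span_singleton_le_iff_mem, (isBalanced_cmv T hv n).snd_eq, ← cmvVec_succ]
  exact sub_mem (smul_mem _ _ (subset_span ⟨_, rfl⟩)) (smul_mem _ _ (subset_span ⟨_, rfl⟩))

theorem map_cmvVec_mem (hv : ‖v‖ = 1) (m : ℕ) :
    T (cmvVec T v m) ∈ span ℂ (Set.range (cmvVec T v)) := by
  have := alternate_cmvVec_mem T hv (m := m) (n := 2 * m) (by omega)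
  rwa [alternate_of_even T (by simp)] at this

theorem symm_cmvVec_mem (hv : ‖v‖ = 1) (m : ℕ) :
    T.symm (cmvVec T v m) ∈ span ℂ (Set.range (cmvVec T v)) := by
  have := alternate_cmvVec_mem T hv (m := m) (n := 2 * m + 1) (by omega)
  rwa [alternate_of_odd T (by simp)] at this

/-- The CMV vectors lie in every subspace that reduces `T` and contains `v`. -/
theorem cmvVec_mem_of_invariant {W : Submodule ℂ H} (h1 : ∀ x ∈ W, T x ∈ W)
    (h2 : ∀ x ∈ W, T.symm x ∈ W) (hv : v ∈ W) (n : ℕ) : cmvVec T v n ∈ W := by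
  have key : cmvVec T v n ∈ W ∧ cmvAux T v n ∈ W := by
    induction n with
    | zero => exact ⟨hv, h1 _ hv⟩
    | succ n ih =>
      refine ⟨smul_mem _ _ (add_mem ih.2 (smul_mem _ _ ih.1)), ?_⟩
      have h3 : szegoSnd (cmvVec T v n) (cmvAux T v n) ∈ W :=
        smul_mem _ _ (add_mem ih.1 (smul_mem _ _ ih.2))
      rw [cmvAux_succ]
      rcases Nat.even_or_odd n with hn | hn
      · rw [alternate_of_even T hn]; exact h2 _ h3
      · rw [alternate_of_odd T hn]; exact h1 _ h3
  exact key.1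

/-- A set of unit vectors generating mutually orthogonal cyclic subspaces. -/
def IsOrthogonalGenerators (S : Set H) : Prop :=
  (∀ v ∈ S, ‖v‖ = 1) ∧
    ∀ v ∈ S, ∀ w ∈ S, v ≠ w → ∀ m n, inner ℂ (cmvVec T v m) (cmvVec T w n) = 0

/-- The space is the orthogonal sum of cyclic subspaces. -/
theorem exists_orthogonalGenerators :
    ∃ S : Set H, IsOrthogonalGenerators T S ∧
      (span ℂ {x | ∃ v ∈ S, ∃ n, x = cmvVec T v n})ᗮ = ⊥ := by
  obtain ⟨S, hS⟩ := zorn_subset {S : Set H | IsOrthogonalGenerators T S} (by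
    intro c hc hchain
    refine ⟨⋃₀ c, ⟨?_, ?_⟩, fun s hs => Set.subset_sUnion_of_mem hs⟩
    · rintro v ⟨s, hs, hv⟩
      exact (hc hs).1 v hv
    · rintro v ⟨s, hs, hv⟩ w ⟨t, ht, hw⟩ hvw
      rcases hchain.total hs ht with h | h
      · exact (hc ht).2 v (h hv) w hw hvw
      · exact (hc hs).2 v hv w (h hw) hvw)
  refine ⟨S, hS.1, ?_⟩
  set K := span ℂ {x | ∃ v ∈ S, ∃ n, x = cmvVec T v n} with hK
  have hle {v : H} (hv : v ∈ S) : span ℂ (Set.range (cmvVec T v)) ≤ K :=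
    span_mono (by rintro _ ⟨n, rfl⟩; exact ⟨v, hv, n, rfl⟩)
  have hT : K ≤ K.comap (T.toLinearEquiv : H →ₗ[ℂ] H) := by
    rw [hK, span_le]
    rintro _ ⟨v, hv, n, rfl⟩
    exact hle hv (map_cmvVec_mem T (hS.1.1 v hv) n)
  have hT' : K ≤ K.comap (T.symm.toLinearEquiv : H →ₗ[ℂ] H) := by
    rw [hK, span_le]
    rintro _ ⟨v, hv, n, rfl⟩
    exact hle hv (symm_cmvVec_mem T (hS.1.1 v hv) n)
  have h1 : ∀ x ∈ Kᗮ, T x ∈ Kᗮ := fun x hx y hy => by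
    rw [← T.symm.inner_map_map, T.symm_apply_apply]
    exact hx _ (hT' hy)
  have h2 : ∀ x ∈ Kᗮ, T.symm x ∈ Kᗮ := fun x hx y hy => by
    rw [← T.inner_map_map, T.apply_symm_apply]
    exact hx _ (hT hy)
  by_contra hne
  obtain ⟨w, hw, hw0⟩ := exists_mem_ne_zero_of_ne_bot hne
  -- A unit vector orthogonal to all the cyclic subspaces would enlarge the maximal family.
  set u := ((‖w‖ : ℂ)⁻¹) • w
  have hu1 : ‖u‖ = 1 := norm_smul_inv_norm hw0
  have huK : u ∈ Kᗮ := smul_mem _ _ hw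
  have huS : ∀ v ∈ S, ∀ m n, inner ℂ (cmvVec T v m) (cmvVec T u n) = 0 := fun v hv m n =>
    cmvVec_mem_of_invariant T h1 h2 huK n _ (subset_span ⟨v, hv, m, rfl⟩)
  have hmax : insert u S ⊆ S := by
    refine hS.2 ⟨?_, ?_⟩ (Set.subset_insert _ _)
    · rintro v (rfl | hv)
      exacts [hu1, hS.1.1 v hv]
    · rintro v (rfl | hv) x (rfl | hx) hvx m n
      · exact absurd rfl hvx
      · rw [inner_eq_zero_symm]; exact huS x hx n m
      · exact huS v hv m n
      · exact hS.1.2 v hv x hx hvx m n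
  have := huS u (hmax (Set.mem_insert _ _)) 0 0
  rw [inner_self_eq_zero] at this
  rw [show u = 0 from this] at hu1
  simp at hu1

end

theorem hasRepresentation_cmv [CompleteSpace H] (T : H ≃ₗᵢ[ℂ] H) :
    HasRepresentation (fun _ c => IsParaTridiagonal c ∧ IsCMV c) (T : H →L[ℂ] H) := by
  obtain ⟨S, ⟨hS1, hS2⟩, hS⟩ := exists_orthogonalGenerators T
  choose N hN0 hN hlt using fun v : S => exists_isSchurParameters T (hS1 v v.2)
  let f : (Σ v : S, MatIdx (N v)) → H := fun x => cmvVec T x.1 x.2.1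
  have hf0 (x) : f x ≠ 0 := (hlt x.1 x.2.1).2 x.2.2
  have hf : Orthonormal ℂ f := by
    refine ⟨fun x => norm_cmvVec T (hS1 x.1 x.1.2) (hf0 x), ?_⟩
    rintro ⟨v, i⟩ ⟨w, j⟩ hne
    by_cases h : v = w
    · subst h
      have hi := hf0 ⟨v, i⟩
      refine (inner_cmvVec T (hS1 v v.2) hi j.1).trans (if_neg ?_)
      rintro h
      exact hne (by rw [Subtype.ext h])
    · exact hS2 v v.2 w w.2 (fun h' => h (Subtype.ext h')) _ _
  have hsp : (span ℂ (Set.range f))ᗮ = ⊥ := by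
    rw [eq_bot_iff, ← hS]
    apply orthogonal_le
    rw [span_le]
    rintro _ ⟨v, hv, n, rfl⟩
    by_cases h0 : cmvVec T v n = 0
    · rw [h0]; exact zero_mem _
    · exact subset_span ⟨⟨⟨v, hv⟩, n, (hlt ⟨v, hv⟩ n).1 h0⟩, rfl⟩
  refine ⟨S, N, fun v => .of fun i j => cmvEntry (schurParam T v) i.1 j.1,
    HilbertBasis.mkOfOrthogonalEqBot hf hsp, hN0, fun v => ?_, ?_⟩
  · have : IsCMV (.of fun i j : MatIdx (N v) => cmvEntry (schurParam T v) i.1 j.1) :=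
      ⟨_, hN v, fun _ _ => rfl⟩
    exact ⟨this.isParaTridiagonal, this⟩
  · rw [HilbertBasis.coe_mkOfOrthogonalEqBot]
    rintro ⟨v, i⟩ ⟨w, j⟩
    -- `HasRepresentation` uses the classical decidability instance.
    let _ : DecidableEq S := fun a b => Classical.propDecidable (a = b)
    by_cases h : v = w
    · subst h
      refine Eq.trans ?_ (Matrix.blockDiagonal'_apply_eq _ _ _ _).symm
      exact inner_cmvVec_map T (hS1 v v.2) (hf0 ⟨v, i⟩) j.1
    · refine Eq.trans ?_ (Matrix.blockDiagonal'_apply_ne _ _ _ h).symm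
      have h1 : span ℂ (Set.range (cmvVec T w)) ≤ (span ℂ {cmvVec T v i.1})ᗮ := by
        rw [span_le]
        rintro _ ⟨n, rfl⟩
        rw [SetLike.mem_coe, mem_orthogonal_singleton_iff_inner_right]
        exact hS2 v v.2 w w.2 (fun h' => h (Subtype.ext h')) _ _
      exact mem_orthogonal_singleton_iff_inner_right.1 (h1 (map_cmvVec_mem T (hS1 w w.2) j.1))

/-! ### Four-diagonal unitary matrices have eigenvectors -/

namespace HilbertBasis

variable {ι : Type*} (b : HilbertBasis ι ℂ H)

theorem mem_span_of_inner_eq_zero {s : Set ι} (hs : s.Finite) {x : H}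
    (hx : ∀ y ∉ s, inner ℂ (b y) x = 0) : x ∈ span ℂ (b '' s) := by
  have h1 := b.hasSum_repr x
  have h2 : HasSum (fun y => b.repr x y • b y) (∑ y ∈ hs.toFinset, b.repr x y • b y) :=
    hasSum_sum_of_ne_finset_zero fun y hy => by
      rw [b.repr_apply_apply, hx y (by simpa using hy), zero_smul]
  rw [h1.unique h2]
  exact sum_mem fun y hy => smul_mem _ _ (subset_span ⟨y, by simpa using hy, rfl⟩)

/-- If two orthogonal vectors have at most one common index in their supports with respect to an
orthonormal basis, then they have none. -/
theorem inner_eq_zero_or_of_disjoint {x y : H} (hxy : inner ℂ x y = 0) (z : ι)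
    (h : ∀ z' ≠ z, inner ℂ (b z') x = 0 ∨ inner ℂ (b z') y = 0) :
    inner ℂ (b z) x = 0 ∨ inner ℂ (b z) y = 0 := by
  have h1 := b.tsum_inner_mul_inner x y
  rw [hxy, tsum_eq_single z, mul_eq_zero] at h1
  · rwa [inner_eq_zero_symm (𝕜 := ℂ) (x := b z) (y := x)]
  · intro z' hz'
    rw [mul_eq_zero, inner_eq_zero_symm (𝕜 := ℂ) (x := x)]
    exact h z' hz'

end HilbertBasis

/-- A unitary operator has no infinite `(1, 2)`-diagonal block with nonvanishing subdiagonal.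
Orthogonality of the columns forces all the entries on and above the diagonal to vanish from row
`3` on, so that the inverse operator maps the span of four basis vectors into the span of three. -/
theorem false_of_infinite_hessenberg_block {ι : Type*} (b : HilbertBasis ι ℂ H) (S : H ≃ₗᵢ[ℂ] H)
    (g : ℕ → ι) (hg : Function.Injective g)
    (hcol : ∀ y j, inner ℂ (b y) (S (b (g j))) ≠ 0 → ∃ i, y = g i ∧ i ≤ j + 1 ∧ j ≤ i + 2)
    (hrow : ∀ i y, inner ℂ (b (g i)) (S (b y)) ≠ 0 → ∃ j, y = g j ∧ i ≤ j + 1 ∧ j ≤ i + 2)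
    (hsub : ∀ j, inner ℂ (b (g (j + 1))) (S (b (g j))) ≠ 0) : False := by
  have key (j j' : ℕ) (hj : j < j') (h : ∀ i, i ≤ j → j' ≤ i + 2 →
      inner ℂ (b (g i)) (S (b (g j))) = 0 ∨ inner ℂ (b (g i)) (S (b (g j'))) = 0) :
      inner ℂ (b (g (j + 1))) (S (b (g j'))) = 0 := by
    refine (b.inner_eq_zero_or_of_disjoint (x := S (b (g j))) ?_ (g (j + 1)) ?_).resolve_left
      (hsub j)
    · rw [S.inner_map_map]
      exact b.orthonormal.2 (hg.ne hj.ne)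
    · intro z hz
      by_contra! hne
      obtain ⟨i, rfl, h1, h2⟩ := hcol _ _ hne.1
      obtain ⟨i', h3, h4, h5⟩ := hcol _ _ hne.2
      obtain rfl := hg h3
      have : i ≠ j + 1 := fun h => hz (by rw [h])
      rcases h i (by omega) h5 with h | h
      exacts [hne.1 h, hne.2 h]
  have d2 (j : ℕ) : inner ℂ (b (g (j + 1))) (S (b (g (j + 3)))) = 0 :=
    key j (j + 3) (by omega) fun i h1 h2 => by omega
  have d1 (j : ℕ) : inner ℂ (b (g (j + 2))) (S (b (g (j + 3)))) = 0 :=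
    key (j + 1) (j + 3) (by omega) fun i h1 h2 => by
      obtain rfl : i = j + 1 := by omega
      exact .inr (d2 j)
  have d0 (j : ℕ) : inner ℂ (b (g (j + 3))) (S (b (g (j + 3)))) = 0 :=
    key (j + 2) (j + 3) (by omega) fun i h1 h2 => by
      obtain rfl | rfl : i = j + 1 ∨ i = j + 2 := by omega
      exacts [.inr (d2 j), .inr (d1 j)]
  -- Rows `0` to `3` are now supported in columns `0` to `2`.
  let W := span ℂ (Set.range fun i : Fin 3 => b (g i))
  have hW (i : Fin 4) : S.symm (b (g i)) ∈ W := by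
    have : Set.range (fun i : Fin 3 => b (g i)) = b '' (g '' Set.Iio 3) := by
      ext x
      simp only [Set.mem_range, Set.mem_image, exists_exists_and_eq_and, Set.mem_Iio]
      exact ⟨fun ⟨i, hi⟩ => ⟨i, i.2, hi⟩, fun ⟨i, h, hi⟩ => ⟨⟨i, h⟩, hi⟩⟩
    change _ ∈ span ℂ _
    rw [this]
    refine b.mem_span_of_inner_eq_zero ((Set.finite_Iio 3).image _) fun y hy => ?_
    rw [← S.inner_map_map, S.apply_symm_apply, inner_eq_zero_symm]
    by_contra hne
    obtain ⟨j, rfl, h1, h2⟩ := hrow _ _ hne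
    have h3 : ¬ j < 3 := fun h => hy ⟨j, h, rfl⟩
    have hi := i.2
    obtain ⟨i, hi'⟩ := i
    obtain ⟨rfl, rfl⟩ | ⟨rfl, rfl⟩ | ⟨rfl, rfl⟩ | ⟨rfl, rfl⟩ | ⟨rfl, rfl⟩ | ⟨rfl, rfl⟩ :
        (i = 1 ∧ j = 3) ∨ (i = 2 ∧ j = 3) ∨ (i = 2 ∧ j = 4) ∨ (i = 3 ∧ j = 3) ∨
          (i = 3 ∧ j = 4) ∨ (i = 3 ∧ j = 5) := by
      simp only at h1 h2; omega
    exacts [hne (d2 0), hne (d1 0), hne (d2 1), hne (d0 0), hne (d1 1), hne (d2 2)]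
  have hli : LinearIndependent ℂ fun i : Fin 4 => S.symm (b (g i)) :=
    ((b.orthonormal.comp (fun i : Fin 4 => g i)
      (hg.comp Fin.val_injective)).comp_linearIsometryEquiv S.symm).linearIndependent
  have h1 := finrank_span_eq_card hli
  have h2 : span ℂ (Set.range fun i : Fin 4 => S.symm (b (g i))) ≤ W :=
    span_le.2 (by rintro _ ⟨i, rfl⟩; exact hW i)
  have : FiniteDimensional ℂ W := FiniteDimensional.span_of_finite ℂ (Set.finite_range _)
  have h3 := finrank_mono h2
  have h4 := finrank_range_le_card (R := ℂ) (fun i : Fin 3 => b (g i))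
  rw [Set.finrank] at h4
  simp only [Fintype.card_fin] at h1 h4
  change _ ≤ Module.finrank ℂ (span ℂ _) at h3
  omega

/-- A unitary operator with a finite block, or with a block decoupling after finitely many rows,
has a nonzero finite-dimensional invariant subspace and hence an eigenvector. -/
theorem exists_eigenvector_of_hessenberg_block {ι : Type*} (b : HilbertBasis ι ℂ H)
    (S : H ≃ₗᵢ[ℂ] H) {N : ℕ∞} (hN : 0 < N) (g : MatIdx N → ι) (hg : Function.Injective g)
    (hcol : ∀ y j, inner ℂ (b y) (S (b (g j))) ≠ 0 →
      ∃ i, y = g i ∧ i.1 ≤ j.1 + 1 ∧ j.1 ≤ i.1 + 2)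
    (hrow : ∀ i y, inner ℂ (b (g i)) (S (b y)) ≠ 0 →
      ∃ j, y = g j ∧ i.1 ≤ j.1 + 1 ∧ j.1 ≤ i.1 + 2) :
    ∃ μ : ℂ, ∃ w : H, w ≠ 0 ∧ S w = μ • w := by
  by_cases hcase : ∃ i : MatIdx N, ∀ j : MatIdx N, j.1 = i.1 + 1 →
      inner ℂ (b (g j)) (S (b (g i))) = 0
  · obtain ⟨i, hi⟩ := hcase
    let s : Set ι := g '' {j | j.1 ≤ i.1}
    have hs : s.Finite :=
      Set.Finite.image _ ((Set.finite_Iic i.1).preimage Subtype.val_injective.injOn)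
    let W := span ℂ (b '' s)
    have : FiniteDimensional ℂ W := FiniteDimensional.span_of_finite ℂ (hs.image _)
    have hiW : b (g i) ∈ W := subset_span ⟨_, ⟨i, Nat.le_refl i.1, rfl⟩, rfl⟩
    have hi0 : b (g i) ≠ 0 := b.orthonormal.ne_zero _
    have : Nontrivial W := ⟨⟨⟨_, hiW⟩, 0, fun h => hi0 (congrArg Subtype.val h)⟩⟩
    have hW : W ≤ W.comap (S.toLinearEquiv : H →ₗ[ℂ] H) := by
      refine span_le.2 ?_
      rintro _ ⟨_, ⟨j, hj, rfl⟩, rfl⟩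
      refine b.mem_span_of_inner_eq_zero hs fun y hy => ?_
      by_contra hne
      obtain ⟨i', rfl, h1, -⟩ := hcol _ _ hne
      have h2 : ¬ i'.1 ≤ i.1 := fun h => hy ⟨i', h, rfl⟩
      have hj : j.1 ≤ i.1 := hj
      obtain rfl : j = i := Subtype.ext (by omega)
      exact hne (hi i' (by omega))
    obtain ⟨μ, hμ⟩ := Module.End.exists_eigenvalue ((S.toLinearEquiv : H →ₗ[ℂ] H).restrict hW)
    obtain ⟨w, hw⟩ := hμ.exists_hasEigenvector
    refine ⟨μ, w, fun h => hw.2 (Subtype.ext h), ?_⟩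
    exact congrArg Subtype.val hw.apply_eq_smul
  · push Not at hcase
    have hlt (n : ℕ) : (n : ℕ∞) < N := by
      induction n with
      | zero => exact hN
      | succ n ih =>
        obtain ⟨j, hj, -⟩ := hcase ⟨n, ih⟩
        rw [← hj]
        exact j.2
    refine (false_of_infinite_hessenberg_block b S (fun n => g ⟨n, hlt n⟩) ?_ ?_ ?_ ?_).elim
    · intro m n h
      exact congrArg Subtype.val (hg h)
    · intro y j h
      obtain ⟨i, h1, h2⟩ := hcol _ _ h
      exact ⟨i.1, h1, h2⟩
    · intro i y h
      obtain ⟨j, h1, h2⟩ := hrow _ _ h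
      exact ⟨j.1, h1, h2⟩
    · intro j
      obtain ⟨i, hi, h⟩ := hcase ⟨j, hlt j⟩
      have : i = ⟨j + 1, hlt _⟩ := Subtype.ext hi
      rwa [this] at h

theorem exists_eigenvector_of_hasNDiagonalRepresentation_four [CompleteSpace H] [Nontrivial H]
    (T : H ≃ₗᵢ[ℂ] H) (hT : HasNDiagonalRepresentation 4 (T : H →L[ℂ] H)) :
    ∃ μ : ℂ, ∃ w : H, w ≠ 0 ∧ T w = μ • w := by
  classical
  obtain ⟨κ, N, M, b, hN, hM, hb⟩ := hT
  obtain ⟨k⟩ : Nonempty κ := by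
    by_contra! hκ
    have := b.dense_span
    rw [Set.range_eq_empty, span_empty,
      (isClosed_singleton (x := (0 : H))).submodule_topologicalClosure_eq] at this
    exact bot_ne_top this
  have hblock (x y) (h : inner ℂ (b x) (T (b y)) ≠ 0) : x.1 = y.1 := by
    by_contra hne
    exact h ((hb x y).trans (Matrix.blockDiagonal'_apply_ne _ _ _ hne))
  have hent (i j : MatIdx (N k)) : inner ℂ (b ⟨k, i⟩) (T (b ⟨k, j⟩)) = M k i j :=
    (hb _ _).trans (Matrix.blockDiagonal'_apply_eq _ _ _ _)
  have hg : Function.Injective fun i : MatIdx (N k) => (⟨k, i⟩ : Σ l, MatIdx (N l)) :=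
    sigma_mk_injective (β := fun l => MatIdx (N l))
  have hsymm (x y) : inner ℂ (b x) (T.symm (b y)) ≠ 0 ↔ inner ℂ (b y) (T (b x)) ≠ 0 := by
    rw [← T.inner_map_map, T.apply_symm_apply, Ne, inner_eq_zero_symm]
  -- A `(2, 1)`-diagonal block of `T` is a `(1, 2)`-diagonal block of the inverse.
  rcases hM k with hband | hband
  · have hband' (i j : MatIdx (N k)) (h : inner ℂ (b ⟨k, i⟩) (T (b ⟨k, j⟩)) ≠ 0) :
        i.1 ≤ j.1 + 2 ∧ j.1 ≤ i.1 + 1 := by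
      by_contra hc
      refine h ((hent i j).trans (hband i j ?_))
      push_cast
      omega
    obtain ⟨μ, w, hw, h⟩ := exists_eigenvector_of_hessenberg_block b T.symm (hN k) _ hg
      (fun y j h => by
        rw [hsymm] at h
        obtain ⟨l, i⟩ := y
        obtain rfl : k = l := hblock _ _ h
        exact ⟨i, rfl, (hband' _ _ h).symm⟩)
      (fun i y h => by
        rw [hsymm] at h
        obtain ⟨l, j⟩ := y
        obtain rfl : l = k := hblock _ _ h
        exact ⟨j, rfl, (hband' _ _ h).symm⟩)
    have h' : w = μ • T w := by rw [← map_smul, ← h, T.apply_symm_apply]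
    refine ⟨μ⁻¹, w, hw, ?_⟩
    have hμ : μ ≠ 0 := by
      rintro rfl
      rw [zero_smul] at h'
      exact hw h'
    nth_rw 2 [h']
    rw [inv_smul_smul₀ hμ]
  · have hband' (i j : MatIdx (N k)) (h : inner ℂ (b ⟨k, i⟩) (T (b ⟨k, j⟩)) ≠ 0) :
        i.1 ≤ j.1 + 1 ∧ j.1 ≤ i.1 + 2 := by
      by_contra hc
      refine h ((hent i j).trans (hband i j ?_))
      push_cast
      omega
    exact exists_eigenvector_of_hessenberg_block b T (hN k) _ hg
      (fun y j h => by
        obtain ⟨l, i⟩ := y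
        obtain rfl : l = k := hblock _ _ h
        exact ⟨i, rfl, hband' _ _ h⟩)
      (fun i y h => by
        obtain ⟨l, j⟩ := y
        obtain rfl : k = l := hblock _ _ h
        exact ⟨j, rfl, hband' _ _ h⟩)

/-! ### A unitary operator without eigenvectors -/

/-- On an infinite-dimensional Hilbert space there is a unitary operator without eigenvectors: a
direct sum of bilateral shifts. -/
theorem exists_linearIsometryEquiv_forall_not_eigenvector [CompleteSpace H]
    (hH : ¬ FiniteDimensional ℂ H) :
    ∃ T : H ≃ₗᵢ[ℂ] H, ∀ (μ : ℂ) (w : H), T w = μ • w → w = 0 := by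
  obtain ⟨ι, b₀, -⟩ := exists_hilbertBasis ℂ H
  have hι : Infinite ι := by
    by_contra hfin
    rw [not_infinite_iff_finite] at hfin
    have := Fintype.ofFinite ι
    exact hH b₀.toOrthonormalBasis.toBasis.finiteDimensional_of_finite
  obtain ⟨e⟩ : Nonempty (ι × ℤ ≃ ι) := by
    rw [← Cardinal.eq]
    simp
  have hbasis (f : ι × ℤ ≃ ι) : ∃ b : HilbertBasis (ι × ℤ) ℂ H, ∀ x, b x = b₀ (f x) :=
    ⟨HilbertBasis.mk (b₀.orthonormal.comp f f.injective) (by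
      rw [Set.range_comp, f.surjective.range_eq, Set.image_univ, b₀.dense_span]),
      fun x => by rw [HilbertBasis.coe_mk]; rfl⟩
  obtain ⟨b, hb⟩ := hbasis e
  obtain ⟨b', hb'⟩ := hbasis (((Equiv.refl ι).prodCongr (Equiv.addRight 1)).trans e)
  let T : H ≃ₗᵢ[ℂ] H := b.repr.trans b'.repr.symm
  have hT (i : ι) (n : ℤ) : T (b (i, n)) = b (i, n + 1) := by
    classical
    change b'.repr.symm (b.repr (b (i, n))) = _
    rw [b.repr_self, b'.repr_symm_single, hb', hb]
    rfl
  refine ⟨T, fun μ w hw => ?_⟩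
  by_contra hw0
  have hμ : ‖μ‖ = 1 := by
    have h := T.norm_map w
    rw [hw, norm_smul] at h
    exact (mul_eq_right₀ (norm_ne_zero_iff.2 hw0)).1 h
  -- The coefficients of an eigenvector have constant modulus along each shift, so they vanish.
  have hstep (i : ι) (n : ℤ) : ‖inner ℂ (b (i, n + 1)) w‖ = ‖inner ℂ (b (i, n)) w‖ := by
    rw [← T.inner_map_map (b (i, n)) w, hT, hw, inner_smul_right, norm_mul, hμ, one_mul]
  have hconst (i : ι) (n : ℤ) : ‖inner ℂ (b (i, n)) w‖ = ‖inner ℂ (b (i, 0)) w‖ := by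
    induction n with
    | zero => rfl
    | succ n ih => rw [hstep, ih]
    | pred n ih => rw [← ih, ← hstep, sub_add_cancel]
  have hzero (x : ι × ℤ) : inner ℂ (b x) w = 0 := by
    obtain ⟨i, n⟩ := x
    have h := (b.orthonormal.inner_products_summable (x := w)).comp_injective
      (Prod.mk_right_injective i)
    simp only [Function.comp_def, hconst] at h
    rw [summable_const_iff] at h
    rw [← norm_eq_zero, hconst]
    exact pow_eq_zero_iff two_ne_zero |>.1 h
  apply hw0
  apply b.repr.injective
  ext x
  rw [b.repr_apply_apply, hzero, map_zero]
  rfl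

theorem mainTheorem1 (H : Type u) [NormedAddCommGroup H] [InnerProductSpace ℂ H]
    [CompleteSpace H] :
    (∀ U ∈ unitary (H →L[ℂ] H),
      HasRepresentation (fun _ c => IsParaTridiagonal c ∧ IsCMV c) U) ∧
    (¬ FiniteDimensional ℂ H →
      IsMinimalRepresentation 5 (unitary (H →L[ℂ] H) : Set (H →L[ℂ] H))) := by
  have hcmv : ∀ U ∈ unitary (H →L[ℂ] H),
      HasRepresentation (fun _ c => IsParaTridiagonal c ∧ IsCMV c) U := fun U hU =>
    hasRepresentation_cmv (Unitary.linearIsometryEquiv ⟨U, hU⟩)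
  refine ⟨hcmv, fun hH => ⟨fun U hU => ?_, fun h => ?_⟩⟩
  · obtain ⟨κ, N, M, b, hN, hM, hb⟩ := hcmv U hU
    exact ⟨κ, N, M, b, hN, fun k => (hM k).1.1, hb⟩
  · obtain ⟨T, hT⟩ := exists_linearIsometryEquiv_forall_not_eigenvector hH
    have : Nontrivial H := by
      by_contra hn
      rw [not_nontrivial_iff_subsingleton] at hn
      exact hH inferInstance
    obtain ⟨μ, w, hw, h⟩ := exists_eigenvector_of_hasNDiagonalRepresentation_four T
      (h _ (Unitary.linearIsometryEquiv.symm T).2)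
    exact hw (hT μ w h)
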